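/- **Theorem 2.7 (Jensen's Trace Inequality for C\*-Algebras).** Let $f$ be a convex, continuous real function on an interval $I\subseteq\mathbb R$, let $\mathcal A$ be a C\*-algebra with multiplier algebra $M(\mathcal A)$ (so $M(\mathcal A)=\mathcal A$ if $\mathcal A$ is unital), and let $\tau$ be a trace on $\mathcal A$, i.e. an additive, positively homogeneous function $\tau:\mathcal A_+\to[0,\infty]$ with $\tau(x^*x)=\tau(xx^*)$ for all $x\in\mathcal A$. Extend $\tau$ to $M(\mathcal A)_+$ by $\tau(m)=\sup\{\tau(a): a\in\mathcal A,\ 0\le a\le m\}$ and, if $\tau$ is finite (i.e. $\tau(x)<\infty$ for all $x\in\mathcal A_+$), to self-adjoint $m\in M(\mathcal A)$ by $\tau(m)=\tau(m_+)-\tau(m_-)$. Let $n\in\mathbb N$, let $x_1,\dots,x_n$ be self-adjoint elements of $\mathcal A$ whose spectra in $M(\mathcal A)$ are contained in $I$, and let $a_1,\dots,a_n\in M(\mathcal A)$ satisfy $\sum_{i=1}^n a_i^*a_i=\mathbf 1$. Then the spectrum of $\sum_i a_i^*x_ia_i$ is contained in $I$, and: 1. If $\tau$ is finite, then $$\tau\Big(f\Big(\sum_{i=1}^n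 a_i^*x_ia_i\Big)\Big)\le\tau\Big(\sum_{i=1}^n a_i^*f(x_i)a_i\Big).\qquad(\ast)$$ In particular, if $\mathcal A$ is unital and $\tau:\mathcal A\to\mathbb C$ is a positive linear functional with $\tau(xy)=\tau(yx)$ for all $x,y$, then $(\ast)$ holds for all self-adjoint $x_i\in\mathcal A$ with spectra in $I$ and all $a_i\in\mathcal A$ with $\sum_i a_i^*a_i=\mathbf 1$. 2. If $\tau$, possibly unbounded, is lower semicontinuous on $\mathcal A_+$ and densely defined (i.e. $\{x\in\mathcal A_+:\tau(x)<\infty\}$ is dense in $\mathcal A_+$), and if $f\ge 0$ on $I$, then $(\ast)$ still holds in $[0,\infty]$, where one or both sides may be infinite. -/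

import Mathlib

open scoped ENNReal NNReal MultiplierAlgebra CStarAlgebra ComplexOrder

/-- The multiplier algebra `M(A)` of a C⋆-algebra is a unital C⋆-algebra. -/
noncomputable instance multiplierCStarAlgebra (A : Type*) [NonUnitalCStarAlgebra A] :
    CStarAlgebra 𝓜(ℂ, A) where

/-- The usual order on `M(A)`: `x ≤ y` iff `y - x` is positive. -/
noncomputable instance multiplierPartialOrder (A : Type*) [NonUnitalCStarAlgebra A] :
    PartialOrder 𝓜(ℂ, A) := CStarAlgebra.spectralOrder _

instance multiplierStarOrderedRing (A : Type*) [NonUnitalCStarAlgebra A] :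
    StarOrderedRing 𝓜(ℂ, A) := CStarAlgebra.spectralOrderedRing _

/-- A (possibly unbounded) trace on a C⋆-algebra `A`: an additive, positively homogeneous
function `τ : A₊ → [0, ∞]` with `τ (x⋆ x) = τ (x x⋆)` for all `x`. Only the values of `toFun`
on the positive cone `A₊` are meaningful. -/
structure CStarTrace (A : Type*) [NonUnitalCStarAlgebra A] [PartialOrder A]
    [StarOrderedRing A] where
  toFun : A → ℝ≥0∞
  map_add' : ∀ x y : A, 0 ≤ x → 0 ≤ y → toFun (x + y) = toFun x + toFun y
  map_smul' : ∀ (r : ℝ≥0) (x : A), 0 ≤ x → toFun ((r : ℝ) • x) = (r : ℝ≥0∞) * toFun x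
  map_star_mul_self' : ∀ x : A, toFun (star x * x) = toFun (x * star x)

namespace CStarTrace

/-- The canonical embedding of `A` in `M(A)` is injective. -/
theorem coe_injective {A : Type*} [NonUnitalCStarAlgebra A] :
    Function.Injective (DoubleCentralizer.coeHom (𝕜 := ℂ) (A := A)) := by
  rw [injective_iff_map_eq_zero]
  intro a ha
  have h := congrArg (fun m : 𝓜(ℂ, A) => m.fst (star a)) ha
  exact CStarRing.mul_star_self_eq_zero_iff a |>.1 (by simpa using h)

variable {A : Type*} [NonUnitalCStarAlgebra A] [PartialOrder A] [StarOrderedRing A]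

/-- `τ` is finite: `τ x < ∞` for every positive `x`. -/
def IsFinite (τ : CStarTrace A) : Prop := ∀ x : A, 0 ≤ x → τ.toFun x < ∞

/-- `τ` is lower semicontinuous on `A₊` (in the norm topology). -/
def IsLSC (τ : CStarTrace A) : Prop := LowerSemicontinuousOn τ.toFun {x : A | 0 ≤ x}

/-- `τ` is densely defined: `{x ∈ A₊ | τ x < ∞}` is dense in `A₊`. -/
def IsDenselyDefined (τ : CStarTrace A) : Prop :=
  ∀ x : A, 0 ≤ x → x ∈ closure {y : A | 0 ≤ y ∧ τ.toFun y < ∞}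

/-- The canonical extension of `τ` to the positive cone of `M(A)`:
`τ(m) = sup {τ(a) | a ∈ A, 0 ≤ a ≤ m}`. -/
noncomputable def ext (τ : CStarTrace A) (m : 𝓜(ℂ, A)) : ℝ≥0∞ :=
  ⨆ (a : A) (_ : 0 ≤ a) (_ : (a : 𝓜(ℂ, A)) ≤ m), τ.toFun a

/-- The canonical extension of a finite trace to the self-adjoint elements of `M(A)`:
`τ(m) = τ(m₊) - τ(m₋)`. Both terms are finite, see `ext_lt_top`. -/
noncomputable def extReal (τ : CStarTrace A) (m : 𝓜(ℂ, A)) : ℝ :=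
  (τ.ext m⁺).toReal - (τ.ext m⁻).toReal

theorem mono (τ : CStarTrace A) {x y : A} (hx : 0 ≤ x) (hxy : x ≤ y) :
    τ.toFun x ≤ τ.toFun y := by
  have h := τ.map_add' x (y - x) hx (sub_nonneg.2 hxy)
  rw [add_sub_cancel] at h
  rw [h]
  exact le_self_add

/-- The embedding of `A` in `M(A)` preserves and reflects the order of positive elements. -/
theorem coe_le_coe {x y : A} (hx : 0 ≤ x) (hy : 0 ≤ y) :
    (x : 𝓜(ℂ, A)) ≤ (y : 𝓜(ℂ, A)) ↔ x ≤ y := by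
  set φ := DoubleCentralizer.coeHom (𝕜 := ℂ) (A := A) with hφ
  change φ x ≤ φ y ↔ x ≤ y
  have hpos : ∀ z : A, 0 ≤ z → 0 ≤ φ z := by
    intro z hz
    obtain ⟨w, rfl⟩ := CStarAlgebra.nonneg_iff_eq_star_mul_self.1 hz
    rw [map_mul, map_star]
    exact star_mul_self_nonneg _
  constructor
  · intro h
    rw [← sub_nonneg, ← map_sub] at h
    have hsa : IsSelfAdjoint (y - x) := hy.isSelfAdjoint.sub hx.isSelfAdjoint
    have hn : φ (y - x)⁻ = (φ (y - x))⁻ := by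
      refine ((CFC.posPart_negPart_unique (a := φ (y - x)) (b := φ (y - x)⁺)
        (c := φ (y - x)⁻) ?_ ?_ ?_ ?_).2).symm
      · rw [← map_sub, CFC.posPart_sub_negPart (y - x) hsa]
      · rw [← map_mul, CFC.posPart_mul_negPart, map_zero]
      · exact hpos _ (CFC.posPart_nonneg _)
      · exact hpos _ (CFC.negPart_nonneg _)
    rw [(CFC.negPart_eq_zero_iff _ (hsa.map φ)).2 h] at hn
    have h0 : (y - x)⁻ = 0 := coe_injective (hn.trans (map_zero φ).symm)
    rw [← sub_nonneg]
    exact (CFC.negPart_eq_zero_iff _ hsa).1 h0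
  · intro h
    rw [← sub_nonneg, ← map_sub]
    exact hpos _ (sub_nonneg.2 h)

/-- On `A₊` the extension agrees with `τ`. -/
theorem ext_coe (τ : CStarTrace A) {x : A} (hx : 0 ≤ x) :
    τ.ext (x : 𝓜(ℂ, A)) = τ.toFun x := by
  refine le_antisymm ?_ ?_
  · exact iSup_le fun a => iSup_le fun ha => iSup_le fun h => τ.mono ha ((coe_le_coe ha hx).1 h)
  · exact le_iSup_of_le x (le_iSup_of_le hx (le_iSup_of_le le_rfl le_rfl))

/-- A finite trace is bounded on the positive part of the unit ball. -/
theorem exists_bound (τ : CStarTrace A) (hτ : τ.IsFinite) :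
    ∃ C : ℝ≥0, ∀ x : A, 0 ≤ x → ‖x‖ ≤ 1 → τ.toFun x ≤ C := by
  by_contra! h
  choose x hx hx1 hlt using fun k : ℕ => h (4 ^ k)
  have hs : Summable fun k : ℕ => ((2⁻¹ : ℝ≥0) ^ k : ℝ) • x k := by
    refine Summable.of_norm_bounded (g := fun k : ℕ => (2⁻¹ : ℝ) ^ k)
      (summable_geometric_of_lt_one (by norm_num) (by norm_num)) fun k => ?_
    rw [norm_smul]
    have : ‖((2⁻¹ : ℝ≥0) ^ k : ℝ)‖ = (2⁻¹ : ℝ) ^ k := by simp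
    rw [this]
    exact mul_le_of_le_one_right (by positivity) (hx1 k)
  have hn : ∀ k : ℕ, 0 ≤ ((2⁻¹ : ℝ≥0) ^ k : ℝ) • x k := fun k => smul_nonneg (by positivity) (hx k)
  set y := ∑' k : ℕ, ((2⁻¹ : ℝ≥0) ^ k : ℝ) • x k
  have hy : 0 ≤ y := tsum_nonneg hn
  have hle : ∀ k : ℕ, (2 : ℝ≥0∞) ^ k ≤ τ.toFun y := by
    intro k
    have h1 := τ.mono (hn k) (hs.le_tsum k fun j _ => hn j)
    have h2 := τ.map_smul' ((2⁻¹ : ℝ≥0) ^ k) (x k) (hx k)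
    rw [NNReal.coe_pow] at h2
    rw [h2] at h1
    refine le_trans ?_ h1
    calc (2 : ℝ≥0∞) ^ k = (((2⁻¹ : ℝ≥0) ^ k : ℝ≥0) : ℝ≥0∞) * ((4 ^ k : ℝ≥0) : ℝ≥0∞) := by
          rw [← ENNReal.coe_mul, ← mul_pow]
          norm_num
      _ ≤ _ := by gcongr; exact (hlt k).le
  have htop : τ.toFun y = ∞ := by
    refine ENNReal.eq_top_of_forall_nnreal_le fun r => ?_
    obtain ⟨k, hk⟩ := pow_unbounded_of_one_lt r (one_lt_two : (1 : ℝ≥0) < 2)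
    exact le_trans (by exact_mod_cast hk.le) (hle k)
  exact (hτ y hy).ne htop

/-- The extension of a finite trace is finite. -/
theorem ext_lt_top (τ : CStarTrace A) (hτ : τ.IsFinite) (m : 𝓜(ℂ, A)) : τ.ext m < ∞ := by
  obtain ⟨C, hC⟩ := τ.exists_bound hτ
  have hb : τ.ext m ≤ ((‖m‖₊ + 1 : ℝ≥0) : ℝ≥0∞) * C := by
    refine iSup_le fun a => iSup_le fun ha => iSup_le fun h => ?_
    have hpos : (0 : 𝓜(ℂ, A)) ≤ (a : 𝓜(ℂ, A)) := by
      have := (coe_le_coe (le_refl (0 : A)) ha).2 ha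
      rwa [show ((0 : A) : 𝓜(ℂ, A)) = 0 from map_zero (DoubleCentralizer.coeHom (𝕜 := ℂ))] at this
    have hn : ‖a‖ ≤ ‖m‖ := by
      rw [← NonUnitalStarAlgHom.norm_map (DoubleCentralizer.coeHom (𝕜 := ℂ)) coe_injective a]
      exact CStarAlgebra.norm_le_norm_of_nonneg_of_le hpos h
    have hp : (0 : ℝ) < ‖m‖ + 1 := by positivity
    have h1 := hC ((‖m‖ + 1)⁻¹ • a) (smul_nonneg (by positivity) ha) (by
      rw [norm_smul, norm_inv, Real.norm_of_nonneg hp.le, inv_mul_le_one₀ hp]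
      linarith)
    have h2 := τ.map_smul' (‖m‖₊ + 1) ((‖m‖ + 1)⁻¹ • a) (smul_nonneg (by positivity) ha)
    rw [smul_smul] at h2
    rw [show (((‖m‖₊ + 1 : ℝ≥0) : ℝ) * (‖m‖ + 1)⁻¹) = 1 from mul_inv_cancel₀ hp.ne', one_smul] at h2
    rw [h2]
    gcongr
  exact hb.trans_lt (ENNReal.mul_lt_top ENNReal.coe_lt_top ENNReal.coe_lt_top)

end CStarTrace

/-! Write `y = ∑ aᵢ⋆ xᵢ aᵢ` and `z = ∑ aᵢ⋆ f(xᵢ) aᵢ`. An affine `l ≤ f` satisfies `l(y) = ∑ aᵢ⋆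
l(xᵢ) aᵢ ≤ z`, but `f(y) ≤ z` fails in general, since the best minorant varies with the point. The
minorants are therefore localised: on a compact interval with `f ≥ 0`, finitely many `l_s` and
functions `h_s` with `∑ h_s² = 1` give `(f - ε)₊ ≤ ∑ h_s l_s h_s`. With `b_s = h_s(y)`, this yields
`(f - ε)₊(y) ≤ ∑ b_s z b_s` (`exists_cfc_max_sub_le_sum_conjugate`). A trace does not see the
difference between `∑ b_s z b_s` and `z` (`ext_sum_conjugate`), and `ε → 0` by lower semicontinuity.

On the multiplier algebra, additivity, traciality and semicontinuity of the extended trace all come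
from comparing `τ(m)` with `τ(w m w⋆)` for contractions `w ∈ A`. Finite traces are lower
semicontinuous, and a constant shift removes the sign condition on `f`. -/

/-! ### Affine minorants and partitions of unity. -/

/-- A nonnegative continuous convex function on a compact convex set of reals is approximated from
below by finitely many affine minorants, glued by a quadratic partition of unity. -/
theorem ConvexOn.exists_finset_affine_partition {K : Set ℝ} {f : ℝ → ℝ} (hK : IsCompact K)
    (hconv : ConvexOn ℝ K f) (hcont : ContinuousOn f K) (hf : ∀ t ∈ K, 0 ≤ f t)
    {ε : ℝ} (hε : 0 < ε) :
    ∃ (S : Finset ℝ) (h : ℝ → ℝ → ℝ) (p q : ℝ → ℝ),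
      (∀ s ∈ S, ContinuousOn (h s) K) ∧
      (∀ t ∈ K, ∑ s ∈ S, h s t * h s t = 1) ∧
      (∀ s ∈ S, ∀ t ∈ K, q s + p s * t ≤ f t) ∧
      (∀ t ∈ K, max (f t - ε) 0 ≤ ∑ s ∈ S, h s t * (q s + p s * t) * h s t) := by
  have key : ∀ s : ℝ, ∃ p q r : ℝ, s ∈ K → 0 < r ∧ (∀ t ∈ K, q + p * t ≤ f t) ∧
      ∀ t ∈ K, dist t s < r → max (f t - ε) 0 ≤ q + p * t := by
    intro s
    by_cases hs : s ∈ K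
    swap
    · exact ⟨0, 0, 0, fun h => absurd h hs⟩
    -- Where `f s < ε`, the truncation vanishes near `s`, so the zero minorant serves.
    by_cases hfs : f s < ε
    · obtain ⟨r, hr, h⟩ := Metric.continuousOn_iff.1 hcont s hs (ε - f s) (sub_pos.2 hfs)
      refine ⟨0, 0, r, fun _ => ⟨hr, fun t ht => by simpa using hf t ht, fun t ht htr => ?_⟩⟩
      have := h t ht htr
      rw [Real.dist_eq, abs_lt] at this
      rw [zero_mul, add_zero]
      exact max_le (by linarith) le_rfl
    · push Not at hfs
      -- Separating at height `f s - ε / 2`, strictly below the graph, works even at an endpoint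
      -- with no finite supporting slope. The height also lies strictly above the truncation at `s`,
      -- so the bound persists nearby.
      obtain ⟨p, q, hle, heq⟩ := hconv.exists_affine_le_of_lt (𝕜 := ℝ) (a := f s - ε / 2) hs
        (by linarith) hK.isClosed hcont.lowerSemicontinuousOn
      have hp : ∀ t, p t = p 1 * t := fun t => by
        have := p.map_smul t 1
        simp only [smul_eq_mul, mul_one] at this
        rw [this, mul_comm]
      have heq' : q + p 1 * s = f s - ε / 2 := by
        rw [← hp, add_comm]; simpa using heq
      have hg : ContinuousOn (fun t => (q + p 1 * t) - max (f t - ε) 0) K := by fun_prop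
      have hpos : 0 < (q + p 1 * s) - max (f s - ε) 0 := by
        rw [heq', sub_pos]
        exact max_lt (by linarith) (by linarith)
      obtain ⟨r, hr, h⟩ := Metric.continuousOn_iff.1 hg s hs _ hpos
      refine ⟨p 1, q, r, fun _ => ⟨hr, fun t ht => ?_, fun t ht htr => ?_⟩⟩
      · have := hle ⟨t, ht⟩
        simp at this
        rw [hp] at this
        linarith
      · have := h t ht htr
        rw [Real.dist_eq, abs_lt] at this
        linarith [this.1]
  choose p q r hpqr using key
  obtain ⟨S, hSK, hcov⟩ := hK.elim_nhds_subcover (fun s => Metric.ball s (r s))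
    (fun s hs => Metric.ball_mem_nhds s (hpqr s hs).1)
  -- Tent functions, positive exactly on the covering balls; the `h s` are the square roots of their
  -- normalisations.
  set w : ℝ → ℝ → ℝ := fun s t => max (r s - dist t s) 0 with hw
  have hw0 : ∀ s t, 0 ≤ w s t := fun s t => le_max_right _ _
  have hwc : ∀ s, Continuous (w s) := fun s => by fun_prop
  set W : ℝ → ℝ := fun t => ∑ s ∈ S, w s t with hW
  have hWpos : ∀ t ∈ K, 0 < W t := by
    intro t ht
    obtain ⟨s, hs, hts⟩ := Set.mem_iUnion₂.1 (hcov ht)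
    exact Finset.sum_pos' (fun s _ => hw0 s t)
      ⟨s, hs, lt_max_of_lt_left (sub_pos.2 (Metric.mem_ball.1 hts))⟩
  have hWc : Continuous W := continuous_finsetSum _ fun s _ => hwc s
  have hsq : ∀ s, ∀ t ∈ K, √(w s t / W t) * √(w s t / W t) = w s t / W t := fun s t ht =>
    Real.mul_self_sqrt (div_nonneg (hw0 s t) (hWpos t ht).le)
  have hone : ∀ t ∈ K, ∑ s ∈ S, w s t / W t = 1 := fun t ht => by
    rw [← Finset.sum_div, div_self (hWpos t ht).ne']
  refine ⟨S, fun s t => √(w s t / W t), p, q, fun s _ => ?_, fun t ht => ?_,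
    fun s hs => (hpqr s (hSK s hs)).2.1, fun t ht => ?_⟩
  · exact ((hwc s).continuousOn.div hWc.continuousOn fun t ht => (hWpos t ht).ne').sqrt
  · rw [← hone t ht]
    exact Finset.sum_congr rfl fun s _ => hsq s t ht
  · calc max (f t - ε) 0 = ∑ s ∈ S, w s t / W t * max (f t - ε) 0 := by
          rw [← Finset.sum_mul, hone t ht, one_mul]
      _ ≤ _ := by
          refine Finset.sum_le_sum fun s hs => ?_
          rw [mul_right_comm, hsq s t ht]
          rcases le_or_gt (r s) (dist t s) with h | h
          · have : w s t = 0 := max_eq_right (sub_nonpos.2 h)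
            simp [this]
          · exact mul_le_mul_of_nonneg_left ((hpqr s (hSK s hs)).2.2 t ht h)
              (div_nonneg (hw0 s t) (hWpos t ht).le)

/-! ### Convex combinations with operator coefficients. -/

section Operator

variable {B : Type*} [CStarAlgebra B] [PartialOrder B] [StarOrderedRing B]

theorem isSelfAdjoint_sum_star_mul_mul {B : Type*} [CStarAlgebra B] {n : ℕ} {x a : Fin n → B} (hx : ∀ i, IsSelfAdjoint (x i)) :
    IsSelfAdjoint (∑ i, star (a i) * x i * a i) :=
  isSelfAdjoint_sum _ fun i _ => (hx i).conjugate' (a i)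

theorem sum_star_mul_mul_le {n : ℕ} {x x' a : Fin n → B} (h : ∀ i, x i ≤ x' i) :
    ∑ i, star (a i) * x i * a i ≤ ∑ i, star (a i) * x' i * a i :=
  Finset.sum_le_sum fun i _ => star_left_conjugate_le_conjugate (h i) (a i)

theorem sum_star_mul_algebraMap_mul {B : Type*} [CStarAlgebra B] {n : ℕ} {a : Fin n → B} (ha : ∑ i, star (a i) * a i = 1)
    (r : ℝ) : ∑ i, star (a i) * algebraMap ℝ B r * a i = algebraMap ℝ B r := by
  simp_rw [← Algebra.commutes r, mul_assoc, ← Finset.mul_sum, ha, mul_one]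

/-- A compact interval encodes two order bounds by scalars, and the map `x ↦ ∑ aᵢ⋆ xᵢ aᵢ` is
monotone and fixes scalars. -/
theorem spectrum_sum_star_mul_mul_subset_of_isCompact {K : Set ℝ} (hK : IsCompact K)
    (hKc : Convex ℝ K) {n : ℕ} {x a : Fin n → B} (hx : ∀ i, IsSelfAdjoint (x i))
    (hxK : ∀ i, spectrum ℝ (x i) ⊆ K) (ha : ∑ i, star (a i) * a i = 1) :
    spectrum ℝ (∑ i, star (a i) * x i * a i) ⊆ K := by
  cases subsingleton_or_nontrivial B
  · simp [spectrum.of_subsingleton]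
  have hn : Nonempty (Fin n) := by
    by_contra h
    rw [not_nonempty_iff] at h
    simp at ha
  obtain ⟨i⟩ := hn
  have hne : K.Nonempty :=
    (ContinuousFunctionalCalculus.spectrum_nonempty (R := ℝ) (x i) (hx i)).mono (hxK i)
  have hIcc := eq_Icc_of_connected_compact ⟨hne, hKc.isPreconnected⟩ hK
  have hy := isSelfAdjoint_sum_star_mul_mul (a := a) hx
  rw [hIcc]
  have hmem : ∀ i, ∀ t ∈ spectrum ℝ (x i), t ∈ Set.Icc (sInf K) (sSup K) := fun i t ht =>
    hIcc ▸ hxK i ht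
  intro t ht
  constructor
  · refine (algebraMap_le_iff_le_spectrum (R := ℝ) hy).1 ?_ t ht
    rw [← sum_star_mul_algebraMap_mul ha]
    exact sum_star_mul_mul_le fun i =>
      (algebraMap_le_iff_le_spectrum (R := ℝ) (hx i)).2 fun t ht => (hmem i t ht).1
  · refine (le_algebraMap_iff_spectrum_le (R := ℝ) hy).1 ?_ t ht
    rw [← sum_star_mul_algebraMap_mul ha (sSup K)]
    exact sum_star_mul_mul_le fun i =>
      (le_algebraMap_iff_spectrum_le (R := ℝ) (hx i)).2 fun t ht => (hmem i t ht).2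

/-- The spectra of finitely many elements in a convex set `I`, and of every convex combination
with operator coefficients, lie in one compact convex subset of `I`. -/
theorem exists_isCompact_spectrum_subset {I : Set ℝ} (hI : Convex ℝ I) {n : ℕ} {x a : Fin n → B}
    (hx : ∀ i, IsSelfAdjoint (x i)) (hxI : ∀ i, spectrum ℝ (x i) ⊆ I)
    (ha : ∑ i, star (a i) * a i = 1) :
    ∃ K ⊆ I, IsCompact K ∧ Convex ℝ K ∧ (∀ i, spectrum ℝ (x i) ⊆ K) ∧
      spectrum ℝ (∑ i, star (a i) * x i * a i) ⊆ K := by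
  set T := ⋃ i, spectrum ℝ (x i) with hT
  have hTc : IsCompact T := isCompact_iUnion fun i => spectrum.isCompact (x i)
  have hTI : T ⊆ I := Set.iUnion_subset hxI
  have hxT : ∀ i, spectrum ℝ (x i) ⊆ T := Set.subset_iUnion fun i => spectrum ℝ (x i)
  obtain ⟨K, hKI, hK, hKc, hTK⟩ : ∃ K ⊆ I, IsCompact K ∧ Convex ℝ K ∧ T ⊆ K := by
    rcases T.eq_empty_or_nonempty with h | h
    · exact ⟨∅, Set.empty_subset I, isCompact_empty, convex_empty, h.subset⟩
    · exact ⟨Set.Icc (sInf T) (sSup T),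
        hI.ordConnected.out (hTI (hTc.sInf_mem h)) (hTI (hTc.sSup_mem h)), isCompact_Icc,
        convex_Icc _ _, fun t ht => ⟨csInf_le hTc.bddBelow ht, le_csSup hTc.bddAbove ht⟩⟩
  exact ⟨K, hKI, hK, hKc, fun i => (hxT i).trans hTK,
    spectrum_sum_star_mul_mul_subset_of_isCompact hK hKc hx (fun i => (hxT i).trans hTK) ha⟩

/-- The operator inequality behind Jensen's trace inequality. -/
theorem exists_cfc_max_sub_le_sum_conjugate {K : Set ℝ} {f : ℝ → ℝ} (hK : IsCompact K)
    (hconv : ConvexOn ℝ K f) (hcont : ContinuousOn f K) (hf : ∀ t ∈ K, 0 ≤ f t)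
    {n : ℕ} {x a : Fin n → B} (hx : ∀ i, IsSelfAdjoint (x i))
    (hxK : ∀ i, spectrum ℝ (x i) ⊆ K) (ha : ∑ i, star (a i) * a i = 1)
    (hyK : spectrum ℝ (∑ i, star (a i) * x i * a i) ⊆ K) {ε : ℝ} (hε : 0 < ε) :
    ∃ (S : Finset ℝ) (b : ℝ → B), (∀ s, IsSelfAdjoint (b s)) ∧ ∑ s ∈ S, b s * b s = 1 ∧
      cfc (fun t => max (f t - ε) 0) (∑ i, star (a i) * x i * a i) ≤
        ∑ s ∈ S, b s * (∑ i, star (a i) * cfc f (x i) * a i) * b s := by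
  obtain ⟨S, h, p, q, hh, hsum, haff, hle⟩ := hconv.exists_finset_affine_partition hK hcont hf hε
  set y := ∑ i, star (a i) * x i * a i with hydef
  have hy : IsSelfAdjoint y := isSelfAdjoint_sum_star_mul_mul hx
  have hhy : ∀ s ∈ S, ContinuousOn (h s) (spectrum ℝ y) := fun s hs => (hh s hs).mono hyK
  have haffy : ∀ s, cfc (fun t => q s + p s * t) y = algebraMap ℝ B (q s) + p s • y := fun s => by
    rw [cfc_const_add _ _ y, cfc_const_mul_id _ y]
  -- Affine functions commute with the operator convex combination; convexity enters only through
  -- the minorants.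
  have hl : ∀ s ∈ S, cfc (fun t => q s + p s * t) y ≤ ∑ i, star (a i) * cfc f (x i) * a i := by
    intro s hs
    calc cfc (fun t => q s + p s * t) y
        = ∑ i, star (a i) * (algebraMap ℝ B (q s) + p s • x i) * a i := by
          rw [haffy, hydef]
          simp_rw [mul_add, add_mul, Finset.sum_add_distrib, sum_star_mul_algebraMap_mul ha,
            mul_smul_comm, smul_mul_assoc, Finset.smul_sum]
      _ ≤ _ := by
          refine sum_star_mul_mul_le fun i => ?_
          rw [← cfc_const_mul_id (p s) (x i), ← cfc_const_add (q s) _ (x i)]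
          exact cfc_mono (fun t ht => haff s hs t (hxK i ht)) (by fun_prop)
            (hcont.mono (hxK i))
  have hb : ∀ s, IsSelfAdjoint (cfc (h s) y) := fun s => cfc_predicate _ _
  refine ⟨S, fun s => cfc (h s) y, hb, ?_, ?_⟩
  · calc ∑ s ∈ S, cfc (h s) y * cfc (h s) y = ∑ s ∈ S, cfc (fun t => h s t * h s t) y :=
          Finset.sum_congr rfl fun s hs => (cfc_mul _ _ y (hhy s hs) (hhy s hs)).symm
      _ = cfc (∑ s ∈ S, fun t => h s t * h s t) y :=
          (cfc_sum _ y S fun s hs => (hhy s hs).mul (hhy s hs)).symm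
      _ = cfc (fun _ => (1 : ℝ)) y := cfc_congr fun t ht => by
          simpa using hsum t (hyK ht)
      _ = 1 := cfc_const_one ℝ y
  · have hc : ∀ s ∈ S, ContinuousOn (fun t => h s t * (q s + p s * t) * h s t) (spectrum ℝ y) :=
      fun s hs => ((hhy s hs).mul (by fun_prop)).mul (hhy s hs)
    -- Each `h s` is placed on both sides of the affine factor, so that the bound `hl` can be
    -- conjugated although `z` need not commute with `y`.
    calc cfc (fun t => max (f t - ε) 0) y
        ≤ cfc (∑ s ∈ S, fun t => h s t * (q s + p s * t) * h s t) y := by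
          have hfy := hcont.mono hyK
          refine cfc_mono (fun t ht => ?_) (by fun_prop) ?_
          · simpa using hle t (hyK ht)
          · rw [Finset.sum_fn]
            exact continuousOn_finsetSum _ hc
      _ = ∑ s ∈ S, cfc (fun t => h s t * (q s + p s * t) * h s t) y := cfc_sum _ y S hc
      _ = ∑ s ∈ S, cfc (h s) y * cfc (fun t => q s + p s * t) y * cfc (h s) y := by
          refine Finset.sum_congr rfl fun s hs => ?_
          rw [cfc_mul (fun t => h s t * (q s + p s * t)) (h s) y
            ((hhy s hs).mul (by fun_prop)) (hhy s hs), cfc_mul _ _ y (hhy s hs) (by fun_prop)]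
      _ ≤ _ := Finset.sum_le_sum fun s hs => (hb s).conjugate_le_conjugate (hl s hs)

end Operator

/-! ### `A` as an ideal of `M(A)`, and compressions `w m w⋆`. -/

section Multiplier

variable {A : Type*} [NonUnitalCStarAlgebra A]

/-- `A` is a left ideal of its multiplier algebra. -/
theorem coe_fst_apply (m : 𝓜(ℂ, A)) (a : A) : ((m.fst a : A) : 𝓜(ℂ, A)) = m * (a : 𝓜(ℂ, A)) := by
  refine DoubleCentralizer.ext ℂ A _ _ (Prod.ext ?_ ?_)
  · refine ContinuousLinearMap.ext fun b => ?_
    change m.fst a * b = m.fst (a * b)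
    rw [← sub_eq_zero, ← CStarRing.star_mul_self_eq_zero_iff]
    -- The difference is annihilated on the left by all of `A`, in particular by its own adjoint.
    have h : ∀ x : A, x * (m.fst a * b - m.fst (a * b)) = 0 := fun x => by
      rw [mul_sub, ← mul_assoc, ← m.central, ← m.central, mul_assoc, sub_self]
    exact h _
  · refine ContinuousLinearMap.ext fun b => ?_
    change b * m.fst a = m.snd b * a
    exact (m.central b a).symm

/-- The element `w m w⋆` of `A`, for a multiplier `m` and `w ∈ A`. -/
noncomputable def conjMultiplier (m : 𝓜(ℂ, A)) (w : A) : A := w * m.fst (star w)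

theorem DoubleCentralizer.coe_mul' (a b : A) :
    ((a * b : A) : 𝓜(ℂ, A)) = (a : 𝓜(ℂ, A)) * (b : 𝓜(ℂ, A)) :=
  map_mul (DoubleCentralizer.coeHom (𝕜 := ℂ) (A := A)) a b

theorem DoubleCentralizer.coe_star' (a : A) :
    ((star a : A) : 𝓜(ℂ, A)) = star (a : 𝓜(ℂ, A)) :=
  map_star (DoubleCentralizer.coeHom (𝕜 := ℂ) (A := A)) a

theorem DoubleCentralizer.coe_zero' : ((0 : A) : 𝓜(ℂ, A)) = 0 :=
  map_zero (DoubleCentralizer.coeHom (𝕜 := ℂ) (A := A))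

theorem DoubleCentralizer.coe_add' (a b : A) :
    ((a + b : A) : 𝓜(ℂ, A)) = (a : 𝓜(ℂ, A)) + (b : 𝓜(ℂ, A)) :=
  map_add (DoubleCentralizer.coeHom (𝕜 := ℂ) (A := A)) a b

theorem IsSelfAdjoint.coe_multiplier {a : A} (ha : IsSelfAdjoint a) :
    IsSelfAdjoint (a : 𝓜(ℂ, A)) :=
  ha.map (DoubleCentralizer.coeHom (𝕜 := ℂ) (A := A))

theorem coe_conjMultiplier (m : 𝓜(ℂ, A)) (w : A) :
    ((conjMultiplier m w : A) : 𝓜(ℂ, A)) = (w : 𝓜(ℂ, A)) * m * star (w : 𝓜(ℂ, A)) := by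
  rw [conjMultiplier, DoubleCentralizer.coe_mul', coe_fst_apply, DoubleCentralizer.coe_star',
    mul_assoc]

theorem conjMultiplier_add (m m' : 𝓜(ℂ, A)) (w : A) :
    conjMultiplier (m + m') w = conjMultiplier m w + conjMultiplier m' w := by
  simp [conjMultiplier, mul_add]

theorem continuous_conjMultiplier (w : A) : Continuous fun m : 𝓜(ℂ, A) => conjMultiplier m w := by
  have h : LipschitzWith (‖w‖₊ * ‖w‖₊) fun m : 𝓜(ℂ, A) => conjMultiplier m w := by
    refine LipschitzWith.of_dist_le_mul fun m m' => ?_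
    have : conjMultiplier m w - conjMultiplier m' w = w * (m - m').fst (star w) := by
      simp [conjMultiplier, mul_sub]
    rw [dist_eq_norm, dist_eq_norm, this]
    calc ‖w * (m - m').fst (star w)‖ ≤ ‖w‖ * (‖(m - m').fst‖ * ‖star w‖) :=
          (norm_mul_le _ _).trans (by gcongr; exact ContinuousLinearMap.le_opNorm _ _)
      _ = _ := by
          rw [DoubleCentralizer.norm_fst, norm_star]
          push_cast
          ring
  exact h.continuous

variable [PartialOrder A] [StarOrderedRing A]

/-- Positivity of `a` is the comparison `a⁻ ≤ a⁺` of positive elements, to which `coe_le_coe`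
applies. -/
theorem coe_nonneg_iff {a : A} (ha : IsSelfAdjoint a) :
    0 ≤ (a : 𝓜(ℂ, A)) ↔ 0 ≤ a := by
  have hp := CFC.posPart_sub_negPart a ha
  have := CStarTrace.coe_le_coe (CFC.negPart_nonneg a) (CFC.posPart_nonneg a)
  rw [← sub_nonneg, ← sub_nonneg (a := a⁺), hp] at this
  rw [← this]
  nth_rw 1 [← hp]
  exact iff_of_eq (congrArg (0 ≤ ·) (map_sub (DoubleCentralizer.coeHom (𝕜 := ℂ)) _ _))

theorem coe_nonneg {a : A} (ha : 0 ≤ a) : 0 ≤ (a : 𝓜(ℂ, A)) :=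
  (coe_nonneg_iff ha.isSelfAdjoint).2 ha

theorem conjMultiplier_nonneg {m : 𝓜(ℂ, A)} (hm : 0 ≤ m) (w : A) : 0 ≤ conjMultiplier m w := by
  have h : 0 ≤ ((conjMultiplier m w : A) : 𝓜(ℂ, A)) := by
    rw [coe_conjMultiplier]
    exact star_right_conjugate_nonneg hm _
  refine (coe_nonneg_iff (CStarTrace.coe_injective ?_)).1 h
  change ((star (conjMultiplier m w) : A) : 𝓜(ℂ, A)) = ((conjMultiplier m w : A) : 𝓜(ℂ, A))
  rw [DoubleCentralizer.coe_star']
  exact h.isSelfAdjoint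

theorem conjMultiplier_mono {m m' : 𝓜(ℂ, A)} (h : m ≤ m') (w : A) :
    conjMultiplier m w ≤ conjMultiplier m' w := by
  rw [← sub_add_cancel m' m, conjMultiplier_add]
  exact le_add_of_nonneg_left (conjMultiplier_nonneg (sub_nonneg.2 h) w)

theorem conjMultiplier_coe {A : Type*} [NonUnitalCStarAlgebra A] (a w : A) : conjMultiplier (a : 𝓜(ℂ, A)) w = w * a * star w :=
  (mul_assoc _ _ _).symm

end Multiplier

/-! ### The extended trace on `M(A)₊`. -/

namespace CStarTrace

variable {A : Type*} [NonUnitalCStarAlgebra A] [PartialOrder A] [StarOrderedRing A]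

theorem toFun_zero (τ : CStarTrace A) : τ.toFun 0 = 0 := by
  simpa using τ.map_smul' 0 0 le_rfl

theorem le_ext (τ : CStarTrace A) {a : A} {m : 𝓜(ℂ, A)} (ha : 0 ≤ a) (h : (a : 𝓜(ℂ, A)) ≤ m) :
    τ.toFun a ≤ τ.ext m :=
  le_iSup_of_le a (le_iSup_of_le ha (le_iSup_of_le h le_rfl))

theorem ext_mono (τ : CStarTrace A) {m m' : 𝓜(ℂ, A)} (h : m ≤ m') : τ.ext m ≤ τ.ext m' :=
  iSup_le fun _ => iSup_le fun ha => iSup_le fun h' => τ.le_ext ha (h'.trans h)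

theorem ext_zero (τ : CStarTrace A) : τ.ext (0 : 𝓜(ℂ, A)) = 0 := by
  rw [← DoubleCentralizer.coe_zero', τ.ext_coe le_rfl, τ.toFun_zero]

/-- A finite trace is continuous, hence lower semicontinuous. -/
theorem IsFinite.isLSC {τ : CStarTrace A} (hτ : τ.IsFinite) : τ.IsLSC := by
  obtain ⟨C, hC⟩ := τ.exists_bound hτ
  have hbound : ∀ a : A, 0 ≤ a → τ.toFun a ≤ (‖a‖₊ : ℝ≥0∞) * C := by
    intro a ha
    rcases eq_or_ne a 0 with rfl | h0
    · simp [τ.toFun_zero]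
    have hn : 0 < ‖a‖ := norm_pos_iff.2 h0
    have hn' : 0 ≤ ‖a‖⁻¹ • a := smul_nonneg (by positivity) ha
    have h2 := τ.map_smul' ‖a‖₊ (‖a‖⁻¹ • a) hn'
    rw [smul_smul, coe_nnnorm, mul_inv_cancel₀ hn.ne', one_smul] at h2
    rw [h2]
    gcongr
    exact hC _ hn' (by rw [norm_smul, norm_inv, norm_norm, inv_mul_cancel₀ hn.ne'])
  -- A Lipschitz estimate, from `a ≤ b + (a - b)⁺` and boundedness of `τ`.
  have hle : ∀ a b : A, 0 ≤ a → 0 ≤ b → τ.toFun a ≤ τ.toFun b + (‖a - b‖₊ : ℝ≥0∞) * C := by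
    intro a b ha hb
    have hp := CFC.posPart_nonneg (a - b)
    calc τ.toFun a ≤ τ.toFun (b + (a - b)⁺) := τ.mono ha (by
          rw [← sub_le_iff_le_add']
          exact CFC.le_posPart (ha.isSelfAdjoint.sub hb.isSelfAdjoint))
      _ = τ.toFun b + τ.toFun (a - b)⁺ := τ.map_add' _ _ hb hp
      _ ≤ _ := by
          gcongr
          refine (hbound _ hp).trans ?_
          gcongr
          exact_mod_cast CStarAlgebra.norm_posPart_le (a - b)
  intro a ha c hc
  have hlim : Filter.Tendsto (fun b : A => c + (‖a - b‖₊ : ℝ≥0∞) * C) (nhds a) (nhds c) := by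
    have h1 : Filter.Tendsto (fun b : A => ((‖a - b‖₊ * C : ℝ≥0) : ℝ≥0∞)) (nhds a) (nhds 0) := by
      have : Continuous fun b : A => ((‖a - b‖₊ * C : ℝ≥0) : ℝ≥0∞) := by fun_prop
      simpa using this.tendsto a
    simpa using (tendsto_const_nhds (x := c)).add h1
  filter_upwards [(hlim.eventually (gt_mem_nhds hc)).filter_mono nhdsWithin_le_nhds,
    self_mem_nhdsWithin] with b hb hb0
  by_contra! h
  exact absurd ((hle a b ha hb0).trans (add_le_add_left h _)) (not_le.2 hb)

/-- Along an approximate unit `w a w → a`, and semicontinuity passes the bound to the limit. -/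
theorem toFun_le_of_forall_conj {τ : CStarTrace A} (hτ : τ.IsLSC) {a : A} (ha : 0 ≤ a) {C : ℝ≥0∞}
    (h : ∀ w : A, ‖w‖ ≤ 1 → τ.toFun (w * a * star w) ≤ C) : τ.toFun a ≤ C := by
  refine le_of_forall_lt fun c hc => ?_
  have hu := CStarAlgebra.increasingApproximateUnit A
  have := hu.neBot
  set l := CStarAlgebra.approximateUnit A
  have hlim : Filter.Tendsto (fun w : A => w * a * w) l (nhds a) := by
    rw [tendsto_iff_norm_sub_tendsto_zero]
    have h1 := tendsto_iff_norm_sub_tendsto_zero.1 (hu.tendsto_mul_right a)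
    have h2 := tendsto_iff_norm_sub_tendsto_zero.1 (hu.tendsto_mul_left a)
    refine squeeze_zero' (Filter.Eventually.of_forall fun _ => norm_nonneg _) ?_
      (by simpa using h1.add h2)
    filter_upwards [hu.eventually_norm] with w hw
    calc ‖w * a * w - a‖ = ‖(w * a - a) * w + (a * w - a)‖ := by congr 1; noncomm_ring
      _ ≤ ‖w * a - a‖ * ‖w‖ + ‖a * w - a‖ := (norm_add_le _ _).trans (by gcongr; exact norm_mul_le _ _)
      _ ≤ ‖w * a - a‖ + ‖a * w - a‖ := by
          gcongr
          exact mul_le_of_le_one_right (norm_nonneg _) hw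
  have hlim' : Filter.Tendsto (fun w : A => w * a * w) l (nhdsWithin a {x : A | 0 ≤ x}) := by
    refine tendsto_nhdsWithin_iff.2 ⟨hlim, ?_⟩
    filter_upwards [hu.eventually_isSelfAdjoint] with w hw
    exact hw.conjugate_nonneg ha
  obtain ⟨w, hw1, hw2, hw3⟩ :=
    ((hlim'.eventually (hτ a ha c hc)).and (hu.eventually_norm.and hu.eventually_star_eq)).exists
  refine hw1.trans_le ?_
  have := h w hw2
  rwa [hw3] at this

/-- Compression turns `a ≤ m` into `w a w⋆ ≤ w m w⋆`, an inequality inside `A`. With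
`toFun_conjMultiplier_le_ext`, this makes `τ(m)` the supremum of `τ(w m w⋆)` over contractions. -/
theorem ext_le_of_forall_conjMultiplier {τ : CStarTrace A} (hτ : τ.IsLSC) {m : 𝓜(ℂ, A)}
    {C : ℝ≥0∞} (h : ∀ w : A, ‖w‖ ≤ 1 → τ.toFun (conjMultiplier m w) ≤ C) : τ.ext m ≤ C := by
  refine iSup_le fun a => iSup_le fun ha => iSup_le fun ham => ?_
  refine toFun_le_of_forall_conj hτ ha fun w hw => ?_
  rw [← conjMultiplier_coe]
  exact (τ.mono (conjMultiplier_nonneg (coe_nonneg ha) w) (conjMultiplier_mono ham w)).trans (h w hw)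

/-- The element `d = b w⋆` lies in `A`, so the trace property there exchanges `d⋆ d = w b⋆ b w⋆`
with `d d⋆ = b w⋆ w b⋆ ≤ b b⋆`. -/
theorem toFun_conjMultiplier_star_mul_self_le (τ : CStarTrace A) (b : 𝓜(ℂ, A)) {w : A}
    (hw : ‖w‖ ≤ 1) : τ.toFun (conjMultiplier (star b * b) w) ≤ τ.ext (b * star b) := by
  set d : A := b.fst (star w) with hd
  have hdc : (d : 𝓜(ℂ, A)) = b * star (w : 𝓜(ℂ, A)) := by
    rw [hd, coe_fst_apply, DoubleCentralizer.coe_star']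
  have h1 : conjMultiplier (star b * b) w = star d * d := by
    refine coe_injective ?_
    change ((conjMultiplier (star b * b) w : A) : 𝓜(ℂ, A)) = ((star d * d : A) : 𝓜(ℂ, A))
    rw [coe_conjMultiplier, DoubleCentralizer.coe_mul', DoubleCentralizer.coe_star', hdc, star_mul,
      star_star]
    simp only [mul_assoc]
  rw [h1, τ.map_star_mul_self']
  refine τ.le_ext (mul_star_self_nonneg d) ?_
  rw [DoubleCentralizer.coe_mul', DoubleCentralizer.coe_star', hdc, star_mul, star_star]
  have hw' : star (w : 𝓜(ℂ, A)) * (w : 𝓜(ℂ, A)) ≤ 1 := by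
    refine CStarAlgebra.norm_le_one_iff_of_nonneg _ (star_mul_self_nonneg _) |>.1 ?_
    rw [CStarRing.norm_star_mul_self]
    have : ‖(w : 𝓜(ℂ, A))‖ = ‖w‖ :=
      NonUnitalStarAlgHom.norm_map (DoubleCentralizer.coeHom (𝕜 := ℂ)) coe_injective w
    rw [this]
    exact mul_le_one₀ hw (norm_nonneg _) hw
  calc b * star (w : 𝓜(ℂ, A)) * ((w : 𝓜(ℂ, A)) * star b)
      = b * (star (w : 𝓜(ℂ, A)) * (w : 𝓜(ℂ, A))) * star b := by simp only [mul_assoc]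
    _ ≤ b * 1 * star b := star_right_conjugate_le_conjugate hw' b
    _ = b * star b := by rw [mul_one]

/-- The extension of a lower semicontinuous trace to the multiplier algebra is tracial. -/
theorem ext_star_mul_self {τ : CStarTrace A} (hτ : τ.IsLSC) (b : 𝓜(ℂ, A)) :
    τ.ext (star b * b) = τ.ext (b * star b) := by
  refine le_antisymm ?_ ?_
  · exact ext_le_of_forall_conjMultiplier hτ fun w hw => τ.toFun_conjMultiplier_star_mul_self_le b hw
  · refine ext_le_of_forall_conjMultiplier hτ fun w hw => ?_
    simpa using τ.toFun_conjMultiplier_star_mul_self_le (star b) hw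

theorem toFun_conjMultiplier_le_ext (τ : CStarTrace A) {m : 𝓜(ℂ, A)} (hm : 0 ≤ m) {w : A}
    (hw : ‖w‖ ≤ 1) : τ.toFun (conjMultiplier m w) ≤ τ.ext m := by
  have hs : IsSelfAdjoint (CFC.sqrt m) := (CFC.sqrt_nonneg m).isSelfAdjoint
  have := τ.toFun_conjMultiplier_star_mul_self_le (CFC.sqrt m) hw
  rwa [hs.star_eq, CFC.sqrt_mul_sqrt_self m hm] at this

/-- The extension of a lower semicontinuous trace to the multiplier algebra is additive. -/
theorem ext_add {τ : CStarTrace A} (hτ : τ.IsLSC) {m m' : 𝓜(ℂ, A)} (hm : 0 ≤ m) (hm' : 0 ≤ m') :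
    τ.ext (m + m') = τ.ext m + τ.ext m' := by
  refine le_antisymm ?_ ?_
  -- An element below `m + m'` need not split into parts below `m` and `m'`, but the compression `w
  -- (m + m') w⋆` does split.
  · refine ext_le_of_forall_conjMultiplier hτ fun w hw => ?_
    rw [conjMultiplier_add, τ.map_add' _ _ (conjMultiplier_nonneg hm w) (conjMultiplier_nonneg hm' w)]
    exact add_le_add (τ.toFun_conjMultiplier_le_ext hm hw) (τ.toFun_conjMultiplier_le_ext hm' hw)
  · have hi : ∀ p : 𝓜(ℂ, A), τ.ext p = ⨆ a : {a : A // 0 ≤ a ∧ (a : 𝓜(ℂ, A)) ≤ p}, τ.toFun a := by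
      intro p
      refine le_antisymm ?_ (iSup_le fun a => τ.le_ext a.2.1 a.2.2)
      exact iSup_le fun a => iSup_le fun ha => iSup_le fun h =>
        le_iSup (fun a : {a : A // 0 ≤ a ∧ (a : 𝓜(ℂ, A)) ≤ p} => τ.toFun a) ⟨a, ha, h⟩
    have hne : ∀ p : 𝓜(ℂ, A), 0 ≤ p → Nonempty {a : A // 0 ≤ a ∧ (a : 𝓜(ℂ, A)) ≤ p} := fun p hp =>
      ⟨0, le_rfl, by rwa [DoubleCentralizer.coe_zero']⟩
    have := hne m hm
    have := hne m' hm'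
    rw [hi m, hi m']
    refine ENNReal.iSup_add_iSup_le fun a b => ?_
    rw [← τ.map_add' _ _ a.2.1 b.2.1]
    refine τ.le_ext (add_nonneg a.2.1 b.2.1) ?_
    rw [DoubleCentralizer.coe_add']
    exact add_le_add a.2.2 b.2.2

theorem ext_sum {τ : CStarTrace A} (hτ : τ.IsLSC) {ι : Type*} (S : Finset ι) {m : ι → 𝓜(ℂ, A)}
    (hm : ∀ i ∈ S, 0 ≤ m i) : τ.ext (∑ i ∈ S, m i) = ∑ i ∈ S, τ.ext (m i) := by
  classical
  induction S using Finset.induction_on with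
  | empty => simpa using τ.ext_zero
  | insert i S hi ih =>
    rw [Finset.sum_insert hi, Finset.sum_insert hi, ext_add hτ (hm i (Finset.mem_insert_self i S))
      (Finset.sum_nonneg fun j hj => hm j (Finset.mem_insert_of_mem hj)),
      ih fun j hj => hm j (Finset.mem_insert_of_mem hj)]

/-- A quadratic partition of unity does not change the trace. -/
theorem ext_sum_conjugate {τ : CStarTrace A} (hτ : τ.IsLSC) {ι : Type*} {S : Finset ι}
    {b : ι → 𝓜(ℂ, A)} (hb : ∀ s, IsSelfAdjoint (b s)) (hS : ∑ s ∈ S, b s * b s = 1)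
    {z : 𝓜(ℂ, A)} (hz : 0 ≤ z) : τ.ext (∑ s ∈ S, b s * z * b s) = τ.ext z := by
  set r := CFC.sqrt z
  have hr : star r = r := (CFC.sqrt_nonneg z).isSelfAdjoint.star_eq
  have hrr : r * r = z := CFC.sqrt_mul_sqrt_self z hz
  -- Traciality applied to `r * b s` moves the `b s` inside, where their squares sum to `1`.
  have h1 : ∀ s, τ.ext (b s * z * b s) = τ.ext (r * (b s * b s) * r) := fun s => by
    have := ext_star_mul_self hτ (r * b s)
    rw [star_mul, hr, (hb s).star_eq] at this
    rw [← hrr]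
    simpa only [mul_assoc] using this
  calc τ.ext (∑ s ∈ S, b s * z * b s) = ∑ s ∈ S, τ.ext (b s * z * b s) :=
        ext_sum hτ S fun s _ => (hb s).conjugate_nonneg hz
    _ = ∑ s ∈ S, τ.ext (r * (b s * b s) * r) := Finset.sum_congr rfl fun s _ => h1 s
    _ = τ.ext (∑ s ∈ S, r * (b s * b s) * r) := by
        refine (ext_sum hτ S fun s _ => ?_).symm
        have : (0 : 𝓜(ℂ, A)) ≤ b s * b s := by
          simpa only [(hb s).star_eq] using star_mul_self_nonneg (b s)
        simpa only [hr] using star_left_conjugate_nonneg this r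
    _ = τ.ext z := by rw [← Finset.sum_mul, ← Finset.mul_sum, hS, mul_one, hrr]

/-- The extension of a lower semicontinuous trace is lower semicontinuous along sequences. -/
theorem ext_le_of_tendsto {τ : CStarTrace A} (hτ : τ.IsLSC) {ι : Type*} {l : Filter ι} [l.NeBot]
    {u : ι → 𝓜(ℂ, A)} {m : 𝓜(ℂ, A)} (hu : Filter.Tendsto u l (nhds m)) (hm : 0 ≤ m)
    (hu0 : ∀ᶠ i in l, 0 ≤ u i) {C : ℝ≥0∞} (h : ∀ᶠ i in l, τ.ext (u i) ≤ C) : τ.ext m ≤ C := by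
  refine ext_le_of_forall_conjMultiplier hτ fun w hw => le_of_forall_lt fun c hc => ?_
  have hlim : Filter.Tendsto (fun i => conjMultiplier (u i) w) l
      (nhdsWithin (conjMultiplier m w) {x : A | 0 ≤ x}) :=
    tendsto_nhdsWithin_iff.2 ⟨((continuous_conjMultiplier w).tendsto m).comp hu,
      hu0.mono fun i hi => conjMultiplier_nonneg hi w⟩
  obtain ⟨i, hi1, hi2, hi3⟩ :=
    ((hlim.eventually (hτ _ (conjMultiplier_nonneg hm w) c hc)).and (hu0.and h)).exists
  exact hi1.trans_le ((τ.toFun_conjMultiplier_le_ext hi2 hw).trans hi3)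

/-- Since `m⁺ + c = (m + c) + m⁻`, additivity and finiteness give the same value for both
differences of positive elements. -/
theorem extReal_eq_sub {τ : CStarTrace A} (hτ : τ.IsFinite) {m c : 𝓜(ℂ, A)} (hm : IsSelfAdjoint m)
    (hc : 0 ≤ c) (hmc : 0 ≤ m + c) :
    τ.extReal m = (τ.ext (m + c)).toReal - (τ.ext c).toReal := by
  have h : τ.ext m⁺ + τ.ext c = τ.ext (m + c) + τ.ext m⁻ := by
    rw [← ext_add hτ.isLSC (CFC.posPart_nonneg m) hc, ← ext_add hτ.isLSC hmc (CFC.negPart_nonneg m)]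
    congr 1
    rw [sub_eq_iff_eq_add.1 (CFC.posPart_sub_negPart m hm)]
    abel
  have := congrArg ENNReal.toReal h
  rw [ENNReal.toReal_add (τ.ext_lt_top hτ _).ne (τ.ext_lt_top hτ _).ne,
    ENNReal.toReal_add (τ.ext_lt_top hτ _).ne (τ.ext_lt_top hτ _).ne] at this
  rw [extReal]
  linarith

end CStarTrace

/-! ### Jensen's inequality under traces. -/

theorem norm_cfc_max_sub_sub_cfc_le {B : Type*} [CStarAlgebra B] {f : ℝ → ℝ} {y : B}
    (hcont : ContinuousOn f (spectrum ℝ y)) (hf : ∀ t ∈ spectrum ℝ y, 0 ≤ f t) {ε : ℝ}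
    (hε : 0 ≤ ε) : ‖cfc (fun t => max (f t - ε) 0) y - cfc f y‖ ≤ ε := by
  rw [← cfc_sub _ f y (by fun_prop) hcont]
  refine norm_cfc_le hε fun t ht => ?_
  have := hf t ht
  rw [Real.norm_eq_abs, abs_le]
  constructor
  · linarith [le_max_left (f t - ε) 0]
  · linarith [max_le (show f t - ε ≤ f t by linarith) this]

section

variable {B : Type*} [CStarAlgebra B] [PartialOrder B] [StarOrderedRing B]

theorem sum_star_mul_cfc_add_const_mul {B : Type*} [CStarAlgebra B] {f : ℝ → ℝ} {n : ℕ} {x a : Fin n → B}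
    (hx : ∀ i, IsSelfAdjoint (x i)) (hcont : ∀ i, ContinuousOn f (spectrum ℝ (x i)))
    (ha : ∑ i, star (a i) * a i = 1) (c : ℝ) :
    ∑ i, star (a i) * cfc (fun t => f t + c) (x i) * a i =
      ∑ i, star (a i) * cfc f (x i) * a i + algebraMap ℝ B c := by
  rw [← sum_star_mul_algebraMap_mul ha c, ← Finset.sum_add_distrib]
  refine Finset.sum_congr rfl fun i _ => ?_
  rw [cfc_add_const c f (x i) (hcont i) (hx i), mul_add, add_mul]

theorem sum_star_mul_cfc_mul_nonneg {f : ℝ → ℝ} {n : ℕ} {x a : Fin n → B}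
    (hf : ∀ i, ∀ t ∈ spectrum ℝ (x i), 0 ≤ f t) :
    0 ≤ ∑ i, star (a i) * cfc f (x i) * a i :=
  Finset.sum_nonneg fun i _ => star_left_conjugate_nonneg (cfc_nonneg (hf i)) _

theorem exists_nonneg_add_of_isCompact {K : Set ℝ} {f : ℝ → ℝ} (hK : IsCompact K)
    (hcont : ContinuousOn f K) : ∃ c : ℝ, 0 ≤ c ∧ ∀ t ∈ K, 0 ≤ f t + c := by
  obtain ⟨c, hc⟩ := hK.exists_bound_of_continuousOn hcont
  refine ⟨max c 0, le_max_right _ _, fun t ht => ?_⟩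
  have h1 := abs_le.1 (hc t ht)
  linarith [le_max_left c 0, h1.1]

/-- **Jensen's trace inequality** for a tracial positive functional on a unital C⋆-algebra. -/
theorem PositiveLinearMap.cfc_sum_conjugate_le {K : Set ℝ} {f : ℝ → ℝ} (hK : IsCompact K)
    (hconv : ConvexOn ℝ K f) (hcont : ContinuousOn f K) {τ : B →ₚ[ℂ] ℂ}
    (hτ : ∀ x y : B, τ (x * y) = τ (y * x)) {n : ℕ} {x a : Fin n → B}
    (hx : ∀ i, IsSelfAdjoint (x i)) (hxK : ∀ i, spectrum ℝ (x i) ⊆ K)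
    (ha : ∑ i, star (a i) * a i = 1) (hyK : spectrum ℝ (∑ i, star (a i) * x i * a i) ⊆ K) :
    τ (cfc f (∑ i, star (a i) * x i * a i)) ≤ τ (∑ i, star (a i) * cfc f (x i) * a i) := by
  obtain ⟨c, -, hfc⟩ := exists_nonneg_add_of_isCompact hK hcont
  have hy : IsSelfAdjoint (∑ i, star (a i) * x i * a i) := isSelfAdjoint_sum_star_mul_mul hx
  have hz := sum_star_mul_cfc_add_const_mul hx (fun i => hcont.mono (hxK i)) ha c
  set y := ∑ i, star (a i) * x i * a i
  set z := ∑ i, star (a i) * cfc f (x i) * a i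
  have key : ∀ ε : ℝ, 0 < ε → τ (cfc f y) ≤ τ z + ε * τ 1 := by
    intro ε hε
    obtain ⟨S, b, hb, hS, hle⟩ := exists_cfc_max_sub_le_sum_conjugate hK (hconv.add_const c)
      (hcont.add continuousOn_const) hfc hx hxK ha hyK hε
    have h1 : cfc f y + algebraMap ℝ B (c - ε) ≤ cfc (fun t => max (f t + c - ε) 0) y := by
      have hfy := hcont.mono hyK
      rw [← cfc_add_const _ f y hfy hy]
      exact cfc_mono (fun t _ => by rw [← add_sub_assoc]; exact le_max_left _ _) (by fun_prop)
        (by fun_prop)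
    -- For a tracial functional the conjugations collapse directly: `τ(b z b) = τ(b b z)`.
    have h2 : τ (∑ s ∈ S, b s * (z + algebraMap ℝ B c) * b s) = τ (z + algebraMap ℝ B c) := by
      simp_rw [map_sum, hτ _ (b _), ← mul_assoc]
      rw [← map_sum, ← Finset.sum_mul, hS, one_mul]
    have hreal : ∀ r : ℝ, τ (algebraMap ℝ B r) = r * τ 1 := fun r => by
      rw [IsScalarTower.algebraMap_apply ℝ ℂ B, Algebra.algebraMap_eq_smul_one, map_smul]
      rfl
    change _ ≤ ∑ s ∈ S, b s * (∑ i, star (a i) * cfc (fun t => f t + c) (x i) * a i) * b s at hle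
    rw [hz] at hle
    have h3 := OrderHomClass.mono τ (h1.trans hle)
    rw [h2, map_add, map_add, hreal, hreal] at h3
    have h4 := add_le_add_left h3 (-((c - ε : ℝ) : ℂ) * τ 1)
    convert h4 using 1
    · ring
    · push_cast
      ring
  have hlim : Filter.Tendsto (fun ε : ℝ => τ z + ε * τ 1) (nhdsWithin 0 (Set.Ioi 0))
      (nhds (τ z)) := by
    have : Continuous fun ε : ℝ => τ z + ε * τ 1 := by fun_prop
    have := this.tendsto 0
    simp only [Complex.ofReal_zero, zero_mul, add_zero] at this
    exact this.mono_left nhdsWithin_le_nhds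
  exact ge_of_tendsto hlim (Filter.eventually_of_mem self_mem_nhdsWithin key)

end

namespace CStarTrace

variable {A : Type*} [NonUnitalCStarAlgebra A] [PartialOrder A] [StarOrderedRing A]

/-- **Jensen's trace inequality** for a lower semicontinuous trace and a nonnegative function. -/
theorem ext_cfc_sum_conjugate_le {K : Set ℝ} {f : ℝ → ℝ} (hK : IsCompact K)
    (hconv : ConvexOn ℝ K f) (hcont : ContinuousOn f K) (hf : ∀ t ∈ K, 0 ≤ f t)
    {τ : CStarTrace A} (hτ : τ.IsLSC) {n : ℕ} {x a : Fin n → 𝓜(ℂ, A)}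
    (hx : ∀ i, IsSelfAdjoint (x i)) (hxK : ∀ i, spectrum ℝ (x i) ⊆ K)
    (ha : ∑ i, star (a i) * a i = 1) (hyK : spectrum ℝ (∑ i, star (a i) * x i * a i) ⊆ K) :
    τ.ext (cfc f (∑ i, star (a i) * x i * a i)) ≤
      τ.ext (∑ i, star (a i) * cfc f (x i) * a i) := by
  have hz : 0 ≤ ∑ i, star (a i) * cfc f (x i) * a i :=
    sum_star_mul_cfc_mul_nonneg fun i t ht => hf t (hxK i ht)
  set y := ∑ i, star (a i) * x i * a i
  -- The truncation keeps the approximants positive, so that semicontinuity on the positive cone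
  -- applies.
  have hlim : Filter.Tendsto (fun ε : ℝ => cfc (fun t => max (f t - ε) 0) y)
      (nhdsWithin 0 (Set.Ioi 0)) (nhds (cfc f y)) := by
    rw [tendsto_iff_norm_sub_tendsto_zero]
    refine squeeze_zero' (Filter.Eventually.of_forall fun _ => norm_nonneg _) ?_
      (Filter.tendsto_id.mono_left nhdsWithin_le_nhds)
    filter_upwards [self_mem_nhdsWithin] with ε hε
    exact norm_cfc_max_sub_sub_cfc_le (hcont.mono hyK) (fun t ht => hf t (hyK ht)) (le_of_lt hε)
  refine ext_le_of_tendsto hτ hlim (cfc_nonneg fun t ht => hf t (hyK ht))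
    (Filter.Eventually.of_forall fun ε => cfc_nonneg fun t _ => le_max_right _ _) ?_
  filter_upwards [self_mem_nhdsWithin] with ε hε
  obtain ⟨S, b, hb, hS, hle⟩ := exists_cfc_max_sub_le_sum_conjugate hK hconv hcont hf hx hxK ha hyK hε
  exact (τ.ext_mono hle).trans_eq (ext_sum_conjugate hτ hb hS hz)

/-- **Jensen's trace inequality** for a finite trace. -/
theorem extReal_cfc_sum_conjugate_le {K : Set ℝ} {f : ℝ → ℝ} (hK : IsCompact K)
    (hconv : ConvexOn ℝ K f) (hcont : ContinuousOn f K)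
    {τ : CStarTrace A} (hτ : τ.IsFinite) {n : ℕ} {x a : Fin n → 𝓜(ℂ, A)}
    (hx : ∀ i, IsSelfAdjoint (x i)) (hxK : ∀ i, spectrum ℝ (x i) ⊆ K)
    (ha : ∑ i, star (a i) * a i = 1) (hyK : spectrum ℝ (∑ i, star (a i) * x i * a i) ⊆ K) :
    τ.extReal (cfc f (∑ i, star (a i) * x i * a i)) ≤
      τ.extReal (∑ i, star (a i) * cfc f (x i) * a i) := by
  obtain ⟨c, hc0, hfc⟩ := exists_nonneg_add_of_isCompact hK hcont
  have hle := ext_cfc_sum_conjugate_le hK (hconv.add_const c) (hcont.add continuousOn_const) hfc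
    hτ.isLSC hx hxK ha hyK
  have hy : IsSelfAdjoint (∑ i, star (a i) * x i * a i) := isSelfAdjoint_sum_star_mul_mul hx
  have hz := sum_star_mul_cfc_add_const_mul hx (fun i => hcont.mono (hxK i)) ha c
  have hz0 : 0 ≤ ∑ i, star (a i) * cfc (fun t => f t + c) (x i) * a i :=
    sum_star_mul_cfc_mul_nonneg fun i t ht => hfc t (hxK i ht)
  set y := ∑ i, star (a i) * x i * a i
  have hyc : cfc (fun t => f t + c) y = cfc f y + algebraMap ℝ 𝓜(ℂ, A) c :=
    cfc_add_const c f y (hcont.mono hyK) hy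
  have hy0 : 0 ≤ cfc (fun t => f t + c) y := cfc_nonneg fun t ht => hfc t (hyK ht)
  have hcc : (0 : 𝓜(ℂ, A)) ≤ algebraMap ℝ 𝓜(ℂ, A) c := algebraMap_nonneg _ hc0
  change τ.ext (cfc (fun t => f t + c) y) ≤
    τ.ext (∑ i, star (a i) * cfc (fun t => f t + c) (x i) * a i) at hle
  rw [hyc] at hle hy0
  rw [hz] at hle hz0
  -- The shift by `c` adds the same finite amount to both sides.
  rw [extReal_eq_sub hτ (cfc_predicate f y) hcc hy0, extReal_eq_sub hτ
    (isSelfAdjoint_sum_star_mul_mul fun i => cfc_predicate f (x i)) hcc hz0]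
  exact sub_le_sub_right (ENNReal.toReal_mono (τ.ext_lt_top hτ _).ne hle) _

end CStarTrace

theorem theorem2p7 (I : Set ℝ) (f : ℝ → ℝ) (hconv : ConvexOn ℝ I f) (hcont : ContinuousOn f I) :
    (∀ (A : Type*) [CStarAlgebra A] [PartialOrder A] [StarOrderedRing A]
        (τ : A →ₚ[ℂ] ℂ), (∀ x y : A, τ (x * y) = τ (y * x)) →
      ∀ (n : ℕ) (x a : Fin n → A),
        (∀ i, IsSelfAdjoint (x i)) → (∀ i, spectrum ℝ (x i) ⊆ I) →
        ∑ i, star (a i) * a i = 1 →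
        spectrum ℝ (∑ i, star (a i) * x i * a i) ⊆ I ∧
        τ (cfc f (∑ i, star (a i) * x i * a i)) ≤ τ (∑ i, star (a i) * cfc f (x i) * a i)) ∧
    (∀ (A : Type*) [NonUnitalCStarAlgebra A] [PartialOrder A] [StarOrderedRing A]
        (τ : CStarTrace A) (n : ℕ) (x : Fin n → A) (a : Fin n → 𝓜(ℂ, A)),
        (∀ i, IsSelfAdjoint (x i)) → (∀ i, spectrum ℝ (x i : 𝓜(ℂ, A)) ⊆ I) →
        ∑ i, star (a i) * a i = 1 →
        spectrum ℝ (∑ i, star (a i) * (x i : 𝓜(ℂ, A)) * a i) ⊆ I ∧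
        (τ.IsFinite →
          τ.extReal (cfc f (∑ i, star (a i) * (x i : 𝓜(ℂ, A)) * a i)) ≤
            τ.extReal (∑ i, star (a i) * cfc f (x i : 𝓜(ℂ, A)) * a i)) ∧
        (τ.IsLSC → τ.IsDenselyDefined → (∀ t ∈ I, 0 ≤ f t) →
          τ.ext (cfc f (∑ i, star (a i) * (x i : 𝓜(ℂ, A)) * a i)) ≤
            τ.ext (∑ i, star (a i) * cfc f (x i : 𝓜(ℂ, A)) * a i))) := by
  refine ⟨fun A _ _ _ τ hτ n x a hx hxI ha => ?_, fun A _ _ _ τ n x a hx hxI ha => ?_⟩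
  -- `I` may be neither closed nor bounded; all spectra involved fit in a compact convex `K ⊆ I`.
  · obtain ⟨K, hKI, hK, hKc, hxK, hyK⟩ := exists_isCompact_spectrum_subset hconv.1 hx hxI ha
    exact ⟨hyK.trans hKI, PositiveLinearMap.cfc_sum_conjugate_le hK (hconv.subset hKI hKc)
      (hcont.mono hKI) hτ hx hxK ha hyK⟩
  · have hx' : ∀ i, IsSelfAdjoint (x i : 𝓜(ℂ, A)) := fun i => (hx i).coe_multiplier
    obtain ⟨K, hKI, hK, hKc, hxK, hyK⟩ := exists_isCompact_spectrum_subset hconv.1 hx' hxI ha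
    refine ⟨hyK.trans hKI, fun hτ => ?_, fun hτ _ hf => ?_⟩
    · exact CStarTrace.extReal_cfc_sum_conjugate_le hK (hconv.subset hKI hKc) (hcont.mono hKI) hτ
        hx' hxK ha hyK
    · exact CStarTrace.ext_cfc_sum_conjugate_le hK (hconv.subset hKI hKc) (hcont.mono hKI)
        (fun t ht => hf t (hKI ht)) hτ hx' hxK ha hyK
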